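/- Let $X$ be a proper (hence complete) CAT(0) metric space with visual boundary $\partial X$ (geodesic rays $[0,\infty)\to X$ modulo bounded distance), and give $X\cup\partial X$ the cone topology. Let $\kappa:[0,\infty)\to[1,\infty)$ be a monotone increasing, concave function with $\lim_{t\to\infty}\kappa(t)/t=0$. Let $c,c'$ be two distinct geodesic rays with $c(0)=c'(0)$, put $\zeta=c(\infty)$ and $\eta=c'(\infty)$, and suppose that $c$ is $\kappa$-contracting: there is a constant $N\ge 0$ such that for every ball $B$, centered at a point $x$ and disjoint from $c$, the nearest-point projection $\pi_c(B)$ of $B$ to $c$ satisfies $\operatorname{diam}\pi_c(B)\le N\kappa(d(c(0),x))$. For a geodesic ray $\gamma$, a horofunction associated to $\gamma$ is a function of the form $b_\gamma+\nu$ with $\nu\in\mathbb R$, where $b_\gamma(x)=\lim_{t\to\infty}(d(x,\gamma(t))-t)$ is the Busemann function of $\gamma$; a horoball centered at $\xi\in\partial X$ is a set $g^{-1}((-\infty,-k])$ with $k\in\mathbb R$ and $g$ a horofunction associated to some geodesic ray $\gamma$ with $\gamma(\infty)=\xi$. Let $h$ be a horofunction associated to $c$ and $H_k=h^{-1}(-k)$.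 Then: (1) every sequence $(x_k)_{k\in\mathbb N}$ in $X$ with $h(x_k)\to-\infty$ converges to $\zeta$ in $X\cup\partial X$; in particular the horospheres $(H_k)_{k\in\mathbb N}$ of $h$ are convergent, that is, $x_k\to\zeta$ whenever $x_k\in H_k$ for all $k$; (2) if $B$ is a horoball centered at $\zeta$ and $B'$ is a horoball centered at $\eta$, then $B\cap B'$ is bounded; (3) if $h'$ is a horofunction associated to $c'$, then $h(c'(s))\to\infty$ as $s\to\infty$ and $h'(c(t))\to\infty$ as $t\to\infty$. -/

import Mathlib

open Set Filter Topology
open scoped NNReal ENNReal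

/-- A metric space is CAT(0) if any two points are joined by a geodesic segment and geodesic
triangles are at least as thin as their Euclidean comparison triangles. In a geodesic space, `x`
lies on some geodesic segment from `p` to `q` iff `dist p x + dist x q = dist p q`. -/
structure IsCAT0 (X : Type*) [MetricSpace X] : Prop where
  exists_geodesic : ∀ x y : X, ∃ γ : ℝ → X, γ 0 = x ∧ γ (dist x y) = y ∧
    ∀ s ∈ Icc 0 (dist x y), ∀ t ∈ Icc 0 (dist x y), dist (γ s) (γ t) = |s - t|
  thin : ∀ (p q r x y : X) (p' q' r' x' y' : EuclideanSpace ℝ (Fin 2)),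
    dist p' q' = dist p q → dist q' r' = dist q r → dist p' r' = dist p r →
    dist p x + dist x q = dist p q → dist p y + dist y r = dist p r →
    x' ∈ segment ℝ p' q' → y' ∈ segment ℝ p' r' →
    dist p' x' = dist p x → dist p' y' = dist p y →
    dist x y ≤ dist x' y'

/-- A (unit speed) geodesic ray: an isometric embedding of `[0, ∞)`. -/
@[ext]
structure GeodesicRay (X : Type*) [MetricSpace X] where
  toFun : ℝ≥0 → X
  isometry : Isometry toFun

namespace GeodesicRay

variable {X : Type*} [MetricSpace X]

instance : CoeFun (GeodesicRay X) (fun _ => ℝ≥0 → X) := ⟨toFun⟩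

/-- Two rays are asymptotic if they stay at bounded distance from each other. -/
def Asymptotic (b c : GeodesicRay X) : Prop :=
  ∃ N : ℝ, ∀ t : ℝ≥0, dist (b t) (c t) ≤ N

/-- Being asymptotic, as an equivalence relation. -/
def asymptoticSetoid (X : Type*) [MetricSpace X] : Setoid (GeodesicRay X) where
  r := Asymptotic
  iseqv :=
    { refl := fun b => ⟨0, fun t => by simp⟩
      symm := fun {b c} ⟨N, h⟩ => ⟨N, fun t => by rw [dist_comm]; exact h t⟩
      trans := fun {b c d} ⟨N, h⟩ ⟨M, k⟩ =>
        ⟨N + M, fun t => (dist_triangle _ (c t) _).trans (add_le_add (h t) (k t))⟩ }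

end GeodesicRay

/-- The visual boundary `∂X`, as a set: geodesic rays up to being asymptotic. -/
def VisualBoundary (X : Type*) [MetricSpace X] : Type _ :=
  Quotient (GeodesicRay.asymptoticSetoid X)

/-- The point at infinity `c(∞)` of a geodesic ray. -/
def GeodesicRay.endpoint {X : Type*} [MetricSpace X] (c : GeodesicRay X) : VisualBoundary X :=
  Quotient.mk (GeodesicRay.asymptoticSetoid X) c

/-- The disjoint union `X ∪ ∂X`. -/
inductive Bordification (X : Type*) [MetricSpace X] : Type _
  | point (x : X) : Bordification X
  | ideal (ξ : VisualBoundary X) : Bordification X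

/-- The basic neighbourhood `U(b, r, ε)` of `b(∞)` in `X ∪ ∂X`: the points `x` of `X` at distance
more than `r` from `b 0` for which the point `y` at distance `r` from `b 0` on the segment
`[b 0, x]` is `ε`-close to `b r`, and the boundary points whose representing ray from `b 0` is
`ε`-close to `b` at time `r`. -/
def coneNhd {X : Type*} [MetricSpace X] (b : GeodesicRay X) (r : ℝ≥0) (ε : ℝ) :
    Set (Bordification X) :=
  Bordification.point '' {x | (r : ℝ) < dist (b 0) x ∧
      ∃ y, dist (b 0) y = r ∧ dist y x = dist (b 0) x - r ∧ dist y (b r) < ε} ∪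
    Bordification.ideal '' {ξ | ∃ c : GeodesicRay X,
      c 0 = b 0 ∧ c.endpoint = ξ ∧ dist (c r) (b r) < ε}

/-- The cone topology on `X ∪ ∂X` with base point `o`, generated by the open balls of `X` and the
sets `U(b, r, ε)` with `b` a ray from `o`. (For complete CAT(0) spaces it does not depend on
`o`.) -/
@[reducible] def coneTopology {X : Type*} [MetricSpace X] (o : X) : TopologicalSpace (Bordification X) :=
  TopologicalSpace.generateFrom
    ({s | ∃ (x : X) (r : ℝ), s = Bordification.point '' Metric.ball x r} ∪
      {s | ∃ (b : GeodesicRay X) (r : ℝ≥0) (ε : ℝ),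
        b 0 = o ∧ 0 < r ∧ 0 < ε ∧ s = coneNhd b r ε})

/-- The sequence `x k` of points of `X` converges to the boundary point `ζ` in `X ∪ ∂X` (for the
cone topology, whatever the base point). -/
def ConvergesToBoundary {X : Type*} [MetricSpace X] (x : ℕ → X) (ζ : VisualBoundary X) : Prop :=
  ∀ o : X, Tendsto (fun k => Bordification.point (x k)) atTop
    (@nhds _ (coneTopology o) (Bordification.ideal ζ))

/-- The Busemann function `b_c(x) = lim_{t → ∞} (d(x, c(t)) - t)`. -/
noncomputable def busemann {X : Type*} [MetricSpace X] (c : GeodesicRay X) (x : X) : ℝ :=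
  limUnder atTop (fun t : ℝ≥0 => dist x (c t) - (t : ℝ))

/-- The limit that defines the Busemann function exists. -/
theorem tendsto_busemann {X : Type*} [MetricSpace X] (c : GeodesicRay X) (x : X) :
    Tendsto (fun t : ℝ≥0 => dist x (c t) - (t : ℝ)) atTop (𝓝 (busemann c x)) := by
  apply tendsto_nhds_limUnder
  refine ⟨_, tendsto_atTop_ciInf ?_ ⟨-dist x (c 0), ?_⟩⟩
  · intro s t hst
    have h1 := dist_triangle x (c s) (c t)
    have h2 : dist (c s) (c t) = t - s := by
      rw [c.isometry.dist_eq, NNReal.dist_eq, abs_sub_comm, abs_of_nonneg]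
      exact sub_nonneg.2 (by exact_mod_cast hst)
    show dist x (c t) - (t : ℝ) ≤ dist x (c s) - (s : ℝ)
    linarith
  · rintro _ ⟨t, rfl⟩
    have h1 := dist_triangle (c 0) x (c t)
    have h2 : dist (c 0) (c t) = t := by
      rw [c.isometry.dist_eq, NNReal.dist_eq, abs_sub_comm, abs_of_nonneg] <;> simp
    rw [dist_comm (c 0) x] at h1
    show -dist x (c 0) ≤ dist x (c t) - (t : ℝ)
    linarith

/-- `h` is a horofunction associated to the ray `c`: a Busemann function plus a constant. -/
def IsHorofunctionOf {X : Type*} [MetricSpace X] (c : GeodesicRay X) (h : X → ℝ) : Prop :=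
  ∃ ν : ℝ, ∀ x, h x = busemann c x + ν

/-- The horosphere `H_k = h⁻¹(-k)`. -/
def horosphere {X : Type*} (h : X → ℝ) (k : ℝ) : Set X := h ⁻¹' {-k}

/-- The horoball `h⁻¹((-∞, -k])`. -/
def horoball {X : Type*} (h : X → ℝ) (k : ℝ) : Set X := h ⁻¹' Iic (-k)

/-- The sequence of `h`-horospheres `H_k`, `k ∈ ℕ`, converges to `ζ`: whenever `x_k ∈ H_k` for all
`k`, the sequence `x_k` converges to `ζ`. -/
def HorospheresConvergeTo {X : Type*} [MetricSpace X] (h : X → ℝ) (ζ : VisualBoundary X) : Prop :=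
  ∀ x : ℕ → X, (∀ k : ℕ, x k ∈ horosphere h k) → ConvergesToBoundary x ζ

/-- `B` is a horoball centered at `ζ`: an `h`-horoball, for a horofunction `h` associated to some
ray representing `ζ`. -/
def IsHoroballAt {X : Type*} [MetricSpace X] (ζ : VisualBoundary X) (B : Set X) : Prop :=
  ∃ d : GeodesicRay X, d.endpoint = ζ ∧ ∃ h : X → ℝ, IsHorofunctionOf d h ∧
    ∃ k : ℝ, B = horoball h k

/-- The gauge functions `κ : [0, ∞) → [1, ∞)`: monotone increasing, concave and sublinear. Only the
values of `κ` on `[0, ∞)` matter. -/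
structure IsSublinearGauge (κ : ℝ → ℝ) : Prop where
  one_le : ∀ t, 0 ≤ t → 1 ≤ κ t
  monotone : MonotoneOn κ (Ici 0)
  concave : ConcaveOn ℝ (Ici 0) κ
  sublinear : Tendsto (fun t => κ t / t) atTop (𝓝 0)

/-- The nearest-point projection `π_b(S)` of a set `S` to the image of the ray `b`. -/
def nearestPointImage {X : Type*} [MetricSpace X] (b : GeodesicRay X) (S : Set X) : Set X :=
  {p | p ∈ range b ∧ ∃ y ∈ S, dist y p = Metric.infDist y (range b)}

/-- The ray `b` is `κ`-contracting: for some constant `N`, every ball centered at a point `x` and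
disjoint from `b` projects to a set of diameter at most `N * κ(‖x‖)`, where `‖x‖ = d(b(0), x)`. -/
def IsContracting {X : Type*} [MetricSpace X] (κ : ℝ → ℝ) (b : GeodesicRay X) : Prop :=
  ∃ N : ℝ, 0 ≤ N ∧ ∀ (x : X) (r : ℝ), Disjoint (Metric.ball x r) (range b) →
    Metric.ediam (nearestPointImage b (Metric.ball x r)) ≤ ENNReal.ofReal (N * κ (dist (b 0) x))

/-! Everything rests on `exists_le_busemann_of_diverging`: if a segment of length `L` leaves `c` (or
an asymptotic ray `d`) early, the Busemann function of `c` at its far end is at least `L / 2 - C`.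
By CAT(0) thinness such a segment moves away from `c` linearly, so balls of radius proportional to
`t` about its point at time `t` miss `c`. Contraction makes their projections sublinearly small, and
a geometric sum shows that the projection of the far end lies at parameter at most a small multiple
of `L`, plus a constant. A geodesic from the far end to `c t` must then go back to near that
projection before following `c`.

Claim (1) is the contrapositive. Claim (3) for `c'` follows from (3) for `c` through a quadratic
comparison, as `c'` need not be contracting. For (2), a far point of both horoballs is reached by a
segment that either leaves `c` early or passes near a point of `c` where `busemann c'` is positive;
convexity then makes `busemann c'` large at the far point. -/

/-- Euclidean comparison triangles exist, with a vertex at the origin. -/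
theorem exists_comparison_triangle {a b c : ℝ} (ha : 0 ≤ a) (hc : 0 ≤ c)
    (h1 : a ≤ b + c) (h2 : b ≤ a + c) (h3 : c ≤ a + b) :
    ∃ q r : EuclideanSpace ℝ (Fin 2), ‖q‖ = a ∧ dist q r = b ∧ ‖r‖ = c := by
  have hb : 0 ≤ b := by linarith
  rcases ha.eq_or_lt with rfl | ha
  · have : b = c := by linarith
    subst this
    refine ⟨0, !₂[b, 0], by simp, ?_, ?_⟩ <;>
      simp [EuclideanSpace.norm_eq, Real.sqrt_sq hb]
  -- The law of cosines gives the first coordinate of `r` when `q` lies on the first axis.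
  · set u : ℝ := (a ^ 2 + c ^ 2 - b ^ 2) / (2 * a) with hu
    have hau : 2 * a * u = a ^ 2 + c ^ 2 - b ^ 2 := by rw [hu]; field_simp
    have huc : u ^ 2 ≤ c ^ 2 := by
      apply sq_le_sq'
      · rw [hu, le_div_iff₀ (by positivity)]
        nlinarith
      · rw [hu, div_le_iff₀ (by positivity)]
        nlinarith
    refine ⟨!₂[a, 0], !₂[u, Real.sqrt (c ^ 2 - u ^ 2)], ?_, ?_, ?_⟩
    · simp [EuclideanSpace.norm_eq, Real.sqrt_sq ha.le]
    · rw [EuclideanSpace.dist_eq, Real.sqrt_eq_iff_eq_sq (by positivity) hb]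
      simp only [Fin.sum_univ_two, Real.dist_eq, sq_abs]
      simp
      rw [Real.sq_sqrt (by linarith)]
      nlinarith
    · rw [EuclideanSpace.norm_eq, Real.sqrt_eq_iff_eq_sq (by positivity) hc]
      simp only [Fin.sum_univ_two, Real.norm_eq_abs, sq_abs]
      simp
      rw [Real.sq_sqrt (by linarith)]
      ring

namespace IsCAT0

variable {X : Type*} [MetricSpace X]

theorem exists_comparison (p q r : X) :
    ∃ q' r' : EuclideanSpace ℝ (Fin 2),
      ‖q'‖ = dist p q ∧ dist q' r' = dist q r ∧ ‖r'‖ = dist p r := by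
  refine exists_comparison_triangle dist_nonneg dist_nonneg ?_ ?_ ?_
  · have := dist_triangle p r q
    rw [dist_comm r q] at this; linarith
  · have := dist_triangle q p r
    rw [dist_comm q p] at this; linarith
  · exact dist_triangle p q r

theorem dist_sq_le (hX : IsCAT0 X) {p q x : X} (r : X) {l : ℝ} (hl0 : 0 ≤ l) (hl1 : l ≤ 1)
    (hpx : dist p x = l * dist p q) (hxq : dist x q = (1 - l) * dist p q) :
    dist x r ^ 2 ≤
      (1 - l) * dist p r ^ 2 + l * dist q r ^ 2 - l * (1 - l) * dist p q ^ 2 := by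
  obtain ⟨q', r', hq, hqr, hr⟩ := exists_comparison p q r
  have key := hX.thin p q r x r 0 q' r' (l • q') r' (by simpa) hqr (by simpa)
    (by rw [hpx, hxq]; ring) (by simp) ⟨1 - l, l, by linarith, hl0, by ring, by simp⟩
    (right_mem_segment ℝ _ _) (by simp [norm_smul, abs_of_nonneg hl0, hq, hpx]) (by simpa)
  have h2 : dist (l • q') r' ^ 2 =
      (1 - l) * dist p r ^ 2 + l * dist q r ^ 2 - l * (1 - l) * dist p q ^ 2 := by
    rw [← hqr, ← hq, ← hr, dist_eq_norm, dist_eq_norm, norm_sub_sq_real, norm_sub_sq_real,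
      norm_smul, real_inner_smul_left, Real.norm_eq_abs, abs_of_nonneg hl0]
    ring
  rw [← h2]
  gcongr

theorem dist_le_convex (hX : IsCAT0 X) {p q x : X} (r : X) {l : ℝ} (hl0 : 0 ≤ l) (hl1 : l ≤ 1)
    (hpx : dist p x = l * dist p q) (hxq : dist x q = (1 - l) * dist p q) :
    dist x r ≤ (1 - l) * dist p r + l * dist q r := by
  have h1 := hX.dist_sq_le r hl0 hl1 hpx hxq
  have h2 : (dist p r - dist q r) ^ 2 ≤ dist p q ^ 2 :=
    sq_le_sq' (by linarith [dist_triangle q p r, dist_comm p q]) (by linarith [dist_triangle p q r])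
  have h3 : 0 ≤ l * (1 - l) := mul_nonneg hl0 (by linarith)
  refine le_of_sq_le_sq ?_ (add_nonneg (mul_nonneg (by linarith) dist_nonneg)
    (mul_nonneg hl0 dist_nonneg))
  nlinarith [mul_le_mul_of_nonneg_left h2 h3]

theorem dist_le_mul_dist (hX : IsCAT0 X) {p q r x y : X} {l : ℝ} (hl0 : 0 ≤ l) (hl1 : l ≤ 1)
    (hpx : dist p x = l * dist p q) (hxq : dist x q = (1 - l) * dist p q)
    (hpy : dist p y = l * dist p r) (hyr : dist y r = (1 - l) * dist p r) :
    dist x y ≤ l * dist q r := by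
  obtain ⟨q', r', hq, hqr, hr⟩ := exists_comparison p q r
  have key := hX.thin p q r x y 0 q' r' (l • q') (l • r') (by simpa) hqr (by simpa)
    (by rw [hpx, hxq]; ring) (by rw [hpy, hyr]; ring)
    ⟨1 - l, l, by linarith, hl0, by ring, by simp⟩
    ⟨1 - l, l, by linarith, hl0, by ring, by simp⟩
    (by simp [norm_smul, abs_of_nonneg hl0, hq, hpx])
    (by simp [norm_smul, abs_of_nonneg hl0, hr, hpy])
  rwa [dist_smul₀, Real.norm_eq_abs, abs_of_nonneg hl0, hqr] at key

end IsCAT0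

namespace GeodesicRay

variable {X : Type*} [MetricSpace X]

/-! ### Rays and their Busemann functions. -/

theorem dist_apply (c : GeodesicRay X) (s t : ℝ≥0) : dist (c s) (c t) = |(s : ℝ) - t| := by
  rw [c.isometry.dist_eq, NNReal.dist_eq]

theorem dist_zero_apply (c : GeodesicRay X) (t : ℝ≥0) : dist (c 0) (c t) = t := by
  simp [dist_apply]

theorem dist_apply_of_le (c : GeodesicRay X) {s t : ℝ≥0} (h : s ≤ t) :
    dist (c s) (c t) = (t : ℝ) - s := by
  rw [dist_apply, abs_sub_comm, abs_of_nonneg (sub_nonneg.2 (by exact_mod_cast h))]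

theorem busemann_le (c : GeodesicRay X) (x : X) (t : ℝ≥0) : busemann c x ≤ dist x (c t) - t := by
  refine le_of_tendsto (tendsto_busemann c x) ?_
  filter_upwards [eventually_ge_atTop t] with s hs
  have h1 := dist_triangle x (c t) (c s)
  rw [c.dist_apply_of_le hs] at h1
  linarith

theorem le_busemann (c : GeodesicRay X) {x : X} {a : ℝ}
    (h : ∀ᶠ t : ℝ≥0 in atTop, a ≤ dist x (c t) - t) : a ≤ busemann c x :=
  ge_of_tendsto (tendsto_busemann c x) h

theorem neg_dist_le_busemann (c : GeodesicRay X) (x : X) : -dist (c 0) x ≤ busemann c x := by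
  refine c.le_busemann (Eventually.of_forall fun t => ?_)
  have h1 := dist_triangle (c 0) x (c t)
  rw [c.dist_zero_apply] at h1
  linarith

theorem busemann_le_add_dist (c : GeodesicRay X) (x y : X) :
    busemann c x ≤ busemann c y + dist x y := by
  have : busemann c x - dist x y ≤ busemann c y := c.le_busemann (Eventually.of_forall fun t => by
    linarith [c.busemann_le x t, dist_triangle x y (c t)])
  linarith

theorem busemann_le_add_of_dist_le {c d : GeodesicRay X} {M : ℝ}
    (h : ∀ t, dist (d t) (c t) ≤ M) (x : X) : busemann c x ≤ busemann d x + M := by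
  have : busemann c x - M ≤ busemann d x := d.le_busemann (Eventually.of_forall fun t => by
    linarith [c.busemann_le x t, dist_triangle x (d t) (c t), h t])
  linarith

theorem asymptotic_of_endpoint_eq {c d : GeodesicRay X} (h : d.endpoint = c.endpoint) :
    Asymptotic d c :=
  Quotient.exact (s := asymptoticSetoid X) h

theorem exists_nearest [ProperSpace X] (c : GeodesicRay X) (x : X) :
    ∃ s : ℝ≥0, dist x (c s) = Metric.infDist x (range c) := by
  have hcl : IsClosed (range c) := c.isometry.isClosedEmbedding.isClosed_range
  obtain ⟨_, ⟨s, rfl⟩, hs⟩ := hcl.exists_infDist_eq_dist (range_nonempty _) x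
  exact ⟨s, hs.symm⟩

theorem infDist_le (c : GeodesicRay X) (x : X) (t : ℝ≥0) :
    Metric.infDist x (range c) ≤ dist x (c t) :=
  Metric.infDist_le_dist_of_mem (mem_range_self t)

theorem le_infDist (c : GeodesicRay X) {x : X} {a : ℝ} (h : ∀ t, a ≤ dist x (c t)) :
    a ≤ Metric.infDist x (range c) := by
  refine (Metric.le_infDist (range_nonempty _)).2 ?_
  rintro _ ⟨t, rfl⟩
  exact h t

/-! ### Projection to a contracting ray. -/

/-- A ray makes an angle of at least `π / 2` with the segment to a point from its projection. -/
theorem sub_le_dist_of_nearest (hX : IsCAT0 X) (c : GeodesicRay X) {y : X} {s : ℝ≥0}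
    (hs : dist y (c s) = Metric.infDist y (range c)) (t : ℝ≥0) :
    (t : ℝ) - s ≤ dist y (c t) := by
  rcases le_or_gt t s with h | h
  · have : (t : ℝ) ≤ s := by exact_mod_cast h
    linarith [dist_nonneg (x := y) (y := c t)]
  have hst : (s : ℝ) < t := by exact_mod_cast h
  refine le_of_sq_le_sq (le_of_forall_pos_le_add fun ε hε => ?_) dist_nonneg
  set A : ℝ := (t : ℝ) - s with hA
  have hA0 : 0 < A := by linarith
  -- First variation at the nearest point: compare `c s` with the point a fraction `l` of the way to
  -- `c t`, divide by `l`, and let `l` tend to `0`.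
  obtain ⟨l, hl0, hl1, hle⟩ : ∃ l : ℝ, 0 < l ∧ l ≤ 1 ∧ l * A ^ 2 ≤ ε := by
    refine ⟨min 1 (ε / A ^ 2), by positivity, min_le_left _ _, ?_⟩
    calc min 1 (ε / A ^ 2) * A ^ 2 ≤ ε / A ^ 2 * A ^ 2 := by gcongr; exact min_le_right _ _
      _ = ε := by field_simp
  set m : ℝ≥0 := s + ⟨l * A, by positivity⟩ with hm
  have hmc : (m : ℝ) = s + l * A := by rw [hm]; rfl
  have hsm : s ≤ m := by rw [hm]; exact le_self_add
  have hmt : m ≤ t := by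
    rw [← NNReal.coe_le_coe, hmc]; nlinarith
  have key := hX.dist_sq_le (p := c s) (q := c t) (x := c m) y hl0.le hl1
    (by rw [c.dist_apply_of_le hsm, c.dist_apply_of_le h.le, hmc]; ring)
    (by rw [c.dist_apply_of_le hmt, c.dist_apply_of_le h.le, hmc]; ring)
  have h1 := c.infDist_le y m
  rw [← hs] at h1
  rw [c.dist_apply_of_le h.le, ← hA, dist_comm _ y, dist_comm _ y, dist_comm _ y] at key
  have h2 : dist y (c s) ^ 2 ≤ dist y (c m) ^ 2 := by gcongr
  have h3 : l * (dist y (c s) ^ 2 + (1 - l) * A ^ 2) ≤ l * dist y (c t) ^ 2 := by nlinarith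
  have h4 := le_of_mul_le_mul_left h3 hl0
  nlinarith [sq_nonneg (dist y (c s))]

/-- The contraction property in terms of parameters of nearest points. -/
theorem abs_sub_le_of_contracting {κ : ℝ → ℝ} {c : GeodesicRay X} {N : ℝ}
    (hN : ∀ (x : X) (r : ℝ), Disjoint (Metric.ball x r) (range c) →
      Metric.ediam (nearestPointImage c (Metric.ball x r)) ≤ ENNReal.ofReal (N * κ (dist (c 0) x)))
    {x y : X} (hκ : 0 ≤ N * κ (dist (c 0) x)) (hxy : dist x y < Metric.infDist x (range c))
    {s t : ℝ≥0} (hs : dist x (c s) = Metric.infDist x (range c))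
    (ht : dist y (c t) = Metric.infDist y (range c)) :
    |(s : ℝ) - t| ≤ N * κ (dist (c 0) x) := by
  have hdisj : Disjoint (Metric.ball x (Metric.infDist x (range c))) (range c) :=
    Metric.disjoint_ball_infDist
  have h1 := hN x _ hdisj
  have hx : c s ∈ nearestPointImage c (Metric.ball x (Metric.infDist x (range c))) :=
    ⟨mem_range_self s, x, Metric.mem_ball_self (dist_nonneg.trans_lt hxy), hs⟩
  have hy : c t ∈ nearestPointImage c (Metric.ball x (Metric.infDist x (range c))) :=
    ⟨mem_range_self t, y, by rwa [Metric.mem_ball, dist_comm], ht⟩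
  have h2 := (Metric.edist_le_ediam_of_mem hx hy).trans h1
  rw [edist_dist] at h2
  rw [← c.dist_apply]
  exact (ENNReal.ofReal_le_ofReal_iff hκ).1 h2

/-- A geodesic from `x` to `c t` spends length about `D` in the largest ball about `x` missing `c`.
Where it exits, its projection is still within `N * κ` of `c s`, so at least `t - s - N * κ`
remains. Finally `D ≥ dist (c 0) x - s`. -/
theorem le_busemann_of_contracting [ProperSpace X] (hX : IsCAT0 X) {κ : ℝ → ℝ}
    {c : GeodesicRay X} {N : ℝ}
    (hN : ∀ (x : X) (r : ℝ), Disjoint (Metric.ball x r) (range c) →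
      Metric.ediam (nearestPointImage c (Metric.ball x r)) ≤ ENNReal.ofReal (N * κ (dist (c 0) x)))
    {x : X} (hκ : 0 ≤ N * κ (dist (c 0) x)) {s : ℝ≥0}
    (hs : dist x (c s) = Metric.infDist x (range c)) :
    dist (c 0) x - 2 * s - N * κ (dist (c 0) x) ≤ busemann c x := by
  refine c.le_busemann (Eventually.of_forall fun t => ?_)
  set D := Metric.infDist x (range c) with hD
  have hDx : dist (c 0) x - s ≤ D := by
    have := dist_triangle (c 0) (c s) x
    rw [c.dist_zero_apply, dist_comm (c s)] at this
    linarith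
  suffices h : D - s - N * κ (dist (c 0) x) ≤ dist x (c t) - t by linarith
  rcases (Metric.infDist_nonneg (x := x) (s := range c)).eq_or_lt with h0 | h0
  · have := c.sub_le_dist_of_nearest hX hs t
    linarith
  refine le_of_forall_pos_le_add fun ε hε => ?_
  obtain ⟨γ, hγ0, hγ1, hγ⟩ := hX.exists_geodesic x (c t)
  set R := max 0 (D - ε) with hR
  have hRD : R < D := max_lt h0 (by linarith)
  have hRt : R ≤ dist x (c t) := hRD.le.trans (c.infDist_le x t)
  have hxy : dist x (γ R) = R := by
    have := hγ 0 ⟨le_rfl, dist_nonneg⟩ R ⟨le_max_left _ _, hRt⟩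
    rw [hγ0] at this
    rw [this, zero_sub, abs_neg, abs_of_nonneg (le_max_left _ _)]
  have hyt : dist (γ R) (c t) = dist x (c t) - R := by
    have := hγ R ⟨le_max_left _ _, hRt⟩ (dist x (c t)) ⟨dist_nonneg, le_rfl⟩
    rw [hγ1] at this
    rw [this, abs_sub_comm, abs_of_nonneg (by linarith)]
  obtain ⟨u, hu⟩ := c.exists_nearest (γ R)
  have h1 := abs_le.1 (abs_sub_le_of_contracting hN hκ (by rw [hxy]; exact hRD) hs hu)
  have h2 := c.sub_le_dist_of_nearest hX hu t
  linarith [le_max_right 0 (D - ε)]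

/-- Along a segment diverging linearly from a sublinearly contracting ray, the nearest-point
projection to the ray moves slowly. -/
theorem nearest_le_of_contracting {κ : ℝ → ℝ} {c : GeodesicRay X} {N : ℝ}
    (hN : ∀ (x : X) (r : ℝ), Disjoint (Metric.ball x r) (range c) →
      Metric.ediam (nearestPointImage c (Metric.ball x r)) ≤ ENNReal.ofReal (N * κ (dist (c 0) x)))
    {γ : ℝ → X} {L a δ β : ℝ} (ha : 0 < a) (hδ : 0 < δ) (hβ : 0 ≤ β)
    (hγ : ∀ s ∈ Icc 0 L, ∀ t ∈ Icc 0 L, dist (γ s) (γ t) = |s - t|)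
    (hfar : ∀ t ∈ Icc a L, δ * t ≤ Metric.infDist (γ t) (range c))
    (hκ0 : ∀ t ∈ Icc a L, 0 ≤ N * κ (dist (c 0) (γ t)))
    (hκ : ∀ t ∈ Icc a L, N * κ (dist (c 0) (γ t)) ≤ β * t)
    {σ : ℝ → ℝ≥0} (hσ : ∀ t, dist (γ t) (c (σ t)) = Metric.infDist (γ t) (range c))
    {t : ℝ} (ht : t ∈ Icc a L) : (σ t : ℝ) ≤ σ a + β * (1 + 2 / δ) * t := by
  have step : ∀ u ∈ Icc a L, ∀ v ∈ Icc a L, u ≤ v → v ≤ (1 + δ / 2) * u →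
      (σ v : ℝ) ≤ σ u + β * u := by
    intro u hu v hv huv hvu
    have hu0 : 0 < u := ha.trans_le hu.1
    have h1 : dist (γ u) (γ v) < Metric.infDist (γ u) (range c) := by
      rw [hγ u ⟨hu0.le, hu.2⟩ v ⟨hu0.le.trans huv, hv.2⟩, abs_sub_comm,
        abs_of_nonneg (by linarith)]
      refine lt_of_lt_of_le ?_ (hfar u hu)
      nlinarith
    have h2 := (abs_le.1 (abs_sub_le_of_contracting hN (hκ0 u hu) h1 (hσ u) (hσ v))).1
    linarith [hκ u hu]
  -- The slope `β * (1 + 2 / δ)` is chosen so that its growth from `u` to `(1 + δ / 2) * u` absorbs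
  -- one step's drift `β * u`.
  have hAB : β * (1 + 2 / δ) * (δ / 2) = β * (δ / 2) + β := by field_simp
  have hA : β ≤ β * (1 + 2 / δ) := by
    have : 0 ≤ β * (2 / δ) := by positivity
    linarith
  have main : ∀ n : ℕ, ∀ t ∈ Icc a L, t ≤ (1 + δ / 2) ^ n * a →
      (σ t : ℝ) ≤ σ a + β * (1 + 2 / δ) * t := by
    intro n
    induction n with
    | zero =>
      intro t ht htn
      obtain rfl : t = a := le_antisymm (by simpa using htn) ht.1
      have : 0 ≤ β * (1 + 2 / δ) * t := mul_nonneg (hβ.trans hA) ha.le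
      linarith
    | succ n ih =>
      intro t ht htn
      have haL : a ≤ L := ht.1.trans ht.2
      rcases le_total t ((1 + δ / 2) * a) with h | h
      · have h1 := step a ⟨le_rfl, haL⟩ t ht ht.1 h
        have h2 : β * a ≤ β * t := mul_le_mul_of_nonneg_left ht.1 hβ
        have h3 := mul_le_mul_of_nonneg_right hA (ha.le.trans ht.1)
        linarith
      · obtain ⟨u, rfl⟩ : ∃ u, t = (1 + δ / 2) * u := ⟨t / (1 + δ / 2), by field_simp⟩
        have hau : a ≤ u := le_of_mul_le_mul_left h (by positivity)
        have hut : u ≤ (1 + δ / 2) * u := by nlinarith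
        have hu : u ∈ Icc a L := ⟨hau, hut.trans ht.2⟩
        have h1 := step u hu _ ht hut le_rfl
        have h2 := ih u hu (le_of_mul_le_mul_left (by rw [pow_succ] at htn; linarith)
          (by positivity : 0 < 1 + δ / 2))
        have h3 : 0 ≤ β * (δ / 2) * u :=
          mul_nonneg (by positivity) (ha.le.trans hau)
        have h4 : β * (1 + 2 / δ) * ((1 + δ / 2) * u)
            = β * (1 + 2 / δ) * u + (β * (δ / 2) + β) * u := by rw [← hAB]; ring
        rw [h4]
        linarith
  obtain ⟨n, hn⟩ := pow_unbounded_of_one_lt (t / a) (by linarith : 1 < 1 + δ / 2)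
  exact main n t ht ((div_le_iff₀ ha).1 hn.le)

theorem exists_gauge_bound {κ : ℝ → ℝ} (hκ : IsSublinearGauge κ) (N : ℝ) {β : ℝ}
    (hβ : 0 < β) : ∃ U : ℝ, 0 < U ∧ ∀ u, U ≤ u → N * κ u ≤ β * u := by
  have h1 : Tendsto (fun t => N * (κ t / t)) atTop (𝓝 0) := by
    simpa using hκ.sublinear.const_mul N
  obtain ⟨U, hU⟩ := eventually_atTop.1 ((h1.eventually_lt_const hβ).and (eventually_gt_atTop 0))
  refine ⟨max U 1, by positivity, fun u hu => ?_⟩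
  obtain ⟨h2, h3⟩ := hU u ((le_max_left _ _).trans hu)
  rw [← mul_div_assoc, div_lt_iff₀ h3] at h2
  exact h2.le

/-! ### Linear growth along diverging segments. -/

/-- The Busemann function of a sublinearly contracting ray grows linearly on the set of endpoints of
segments that diverge from the ray. -/
theorem exists_le_busemann_of_diverging [ProperSpace X] (hX : IsCAT0 X) {κ : ℝ → ℝ}
    (hκ : IsSublinearGauge κ) {c d : GeodesicRay X} (hc : IsContracting κ c)
    (hdc : Asymptotic d c) {r : ℝ≥0} (hr : 0 < r) {ε : ℝ} (hε : 0 < ε) :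
    ∃ C : ℝ, ∀ (L : ℝ) (γ : ℝ → X), γ 0 = d 0 → (r : ℝ) ≤ L →
      (∀ s ∈ Icc 0 L, ∀ t ∈ Icc 0 L, dist (γ s) (γ t) = |s - t|) →
      ε ≤ dist (γ r) (d r) → L / 2 - C ≤ busemann c (γ L) := by
  obtain ⟨N, hN0, hN⟩ := hc
  obtain ⟨M, hM⟩ := hdc
  have hr' : (0 : ℝ) < r := hr
  have hM0 : 0 ≤ M := dist_nonneg.trans (hM 0)
  -- Thinness gives distance `4 * δ * t` to `d` at equal times; allowing other times on `d` halves
  -- this, and passing from `d` to `c` costs `M ≤ δ * t`.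
  set δ : ℝ := ε / (4 * r) with hδ
  have hδ0 : 0 < δ := by positivity
  -- The final loss is twice the projection parameter plus one gauge term, at most `2 * (L / 6) + L
  -- / 6 = L / 2` up to constants.
  obtain ⟨β, hβ0, hβ⟩ : ∃ β : ℝ, 0 < β ∧ β * (1 + 2 / δ) ≤ 1 / 6 :=
    ⟨1 / 6 / (1 + 2 / δ), by positivity, by rw [div_mul_cancel₀ _ (by positivity)]⟩
  obtain ⟨U, hU0, hU⟩ := exists_gauge_bound hκ N (half_pos hβ0)
  obtain ⟨a, ha⟩ : ∃ a : ℝ, a = r + M + U + M / δ := ⟨_, rfl⟩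
  have hMδ : 0 ≤ M / δ := by positivity
  have ha0 : 0 < a := by linarith
  refine ⟨6 * (a + M), fun L γ hγ0 hrL hγ hεr => ?_⟩
  have hL0 : 0 ≤ L := hr'.le.trans hrL
  have hrad : ∀ t ∈ Icc 0 L, dist (d 0) (γ t) = t := fun t ht => by
    rw [← hγ0, hγ 0 ⟨le_rfl, hL0⟩ t ht, zero_sub, abs_neg, abs_of_nonneg ht.1]
  have hnorm1 : ∀ t ∈ Icc 0 L, dist (c 0) (γ t) ≤ t + M := fun t ht => by
    linarith [dist_triangle (c 0) (d 0) (γ t), hrad t ht, hM 0, dist_comm (c 0) (d 0)]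
  have hnorm2 : ∀ t ∈ Icc 0 L, t - M ≤ dist (c 0) (γ t) := fun t ht => by
    linarith [dist_triangle (d 0) (c 0) (γ t), hrad t ht, hM 0]
  have hL : L ∈ Icc 0 L := ⟨hL0, le_rfl⟩
  rcases lt_or_ge L a with hLa | hLa
  · linarith [c.neg_dist_le_busemann (γ L), hnorm1 L hL]
  have hIcc : ∀ t ∈ Icc a L, t ∈ Icc 0 L := fun t ht => ⟨ha0.le.trans ht.1, ht.2⟩
  have hfar : ∀ t ∈ Icc a L, δ * t ≤ Metric.infDist (γ t) (range c) := by
    intro t ht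
    have ht0 : 0 < t := ha0.trans_le ht.1
    have hrt : (r : ℝ) ≤ t := by linarith [ht.1]
    obtain ⟨T, hT⟩ : ∃ T : ℝ≥0, (T : ℝ) = t := ⟨t.toNNReal, Real.coe_toNNReal t ht0.le⟩
    have hdiv : ε ≤ r / t * dist (γ t) (d T) := by
      refine hεr.trans (hX.dist_le_mul_dist (p := d 0) (by positivity)
        ((div_le_one ht0).2 hrt) ?_ ?_ ?_ ?_)
      · rw [hrad _ ⟨hr'.le, hrL⟩, hrad t (hIcc t ht)]; field_simp
      · rw [hγ _ ⟨hr'.le, hrL⟩ t (hIcc t ht), hrad t (hIcc t ht), abs_sub_comm,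
          abs_of_nonneg (by linarith)]
        field_simp
      · rw [d.dist_zero_apply, d.dist_zero_apply, hT]
        field_simp
      · rw [d.dist_apply, d.dist_zero_apply, abs_sub_comm, hT, abs_of_nonneg (by linarith)]
        field_simp
    have hdiv' : 4 * δ * t ≤ dist (γ t) (d T) := by
      rw [div_mul_eq_mul_div, le_div_iff₀ ht0] at hdiv
      have : 4 * δ * t = ε * t / r := by rw [hδ]; field_simp
      rw [this, div_le_iff₀ hr']
      linarith
    refine c.le_infDist fun s => ?_
    have h1 : dist (d s) (d T) ≤ dist (γ t) (d s) := by
      have h2 := abs_dist_sub_le (d s) (γ t) (d 0)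
      rw [dist_comm _ (d 0), dist_comm _ (d 0), d.dist_zero_apply, hrad t (hIcc t ht)] at h2
      rw [d.dist_apply, hT, dist_comm (γ t)]
      exact h2
    have h3 : M ≤ δ * t := by
      have : M / δ ≤ t := by linarith [ht.1]
      rw [div_le_iff₀ hδ0] at this
      linarith
    linarith [dist_triangle (γ t) (d s) (d T), dist_triangle (γ t) (c s) (d s), hM s,
      dist_comm (c s) (d s)]
  have hκ0 : ∀ x, 0 ≤ N * κ (dist (c 0) x) := fun x =>
    mul_nonneg hN0 (zero_le_one.trans (hκ.one_le _ dist_nonneg))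
  have hκβ : ∀ t ∈ Icc a L, N * κ (dist (c 0) (γ t)) ≤ β * t := fun t ht => by
    have h1 := hnorm1 t (hIcc t ht)
    refine (hU _ (by linarith [hnorm2 t (hIcc t ht), ht.1])).trans ?_
    have : β / 2 * dist (c 0) (γ t) ≤ β / 2 * (2 * t) := by
      gcongr
      linarith [ht.1]
    linarith
  choose σ hσ using fun t => c.exists_nearest (γ t)
  have hσL := nearest_le_of_contracting hN ha0 hδ0 hβ0.le hγ hfar (fun t _ => hκ0 _) hκβ hσ
    ⟨hLa, le_rfl⟩
  have hσa : (σ a : ℝ) ≤ 2 * (a + M) := by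
    have h1 := dist_triangle (c 0) (γ a) (c (σ a))
    have h2 := c.infDist_le (γ a) 0
    rw [← hσ, dist_comm _ (c 0)] at h2
    rw [c.dist_zero_apply] at h1
    linarith [hnorm1 a ⟨ha0.le, hLa⟩]
  have h1 := le_busemann_of_contracting hX hN (hκ0 (γ L)) (hσ L)
  have h2 : β * (1 + 2 / δ) * L ≤ 1 / 6 * L := by gcongr
  have h3 := hκβ L ⟨hLa, le_rfl⟩
  have h4 : β * L ≤ 1 / 6 * L := by
    have : 0 ≤ β * (2 / δ) := by positivity
    gcongr
    linarith
  linarith [hnorm2 L hL]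

/-! ### Two distinct rays from one point. -/

theorem exists_ne_of_ne {c c' : GeodesicRay X} (h0 : c 0 = c' 0) (hne : c ≠ c') :
    ∃ r : ℝ≥0, 0 < r ∧ c' r ≠ c r := by
  obtain ⟨r, hr⟩ : ∃ r, c' r ≠ c r := by
    by_contra! hall
    exact hne (GeodesicRay.ext (funext fun r => (hall r).symm))
  exact ⟨r, pos_iff_ne_zero.2 (by rintro rfl; exact hr h0.symm), hr⟩

theorem asymptotic_refl (c : GeodesicRay X) : Asymptotic c c := ⟨0, fun t => by simp⟩

theorem exists_le_busemann_apply [ProperSpace X] (hX : IsCAT0 X) {κ : ℝ → ℝ}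
    (hκ : IsSublinearGauge κ) {c c' : GeodesicRay X} (hc : IsContracting κ c) (h0 : c 0 = c' 0)
    (hne : c ≠ c') : ∃ C : ℝ, ∀ᶠ s : ℝ≥0 in atTop, (s : ℝ) / 2 - C ≤ busemann c (c' s) := by
  obtain ⟨r, hr0, hr⟩ := exists_ne_of_ne h0 hne
  obtain ⟨C, hC⟩ :=
    exists_le_busemann_of_diverging hX hκ hc c.asymptotic_refl hr0 (dist_pos.2 hr)
  refine ⟨C, ?_⟩
  filter_upwards [eventually_ge_atTop r] with s hs
  have := hC s (fun t => c' t.toNNReal) (by simp [h0]) (by exact_mod_cast hs)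
    (fun u hu v hv => by
      rw [c'.dist_apply, Real.coe_toNNReal _ hu.1, Real.coe_toNNReal _ hv.1]) (by simp)
  simpa using this

/-- Limit as `T → ∞` of the CAT(0) inequality for the triangle `c' 0`, `c' T`, `c u` at the point
`c' u`. It turns separation of the rays into a lower bound for `busemann c'` on `c`. -/
theorem dist_sq_le_busemann (hX : IsCAT0 X) {c c' : GeodesicRay X} (h0 : c 0 = c' 0) (u : ℝ≥0) :
    dist (c u) (c' u) ^ 2 ≤ 2 * (u : ℝ) ^ 2 + 2 * u * busemann c' (c u) := by
  have hT : Tendsto (fun T : ℝ≥0 => (T : ℝ)) atTop atTop := NNReal.tendsto_coe_atTop.2 tendsto_id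
  have hb := tendsto_busemann c' (c u)
  have hinv : Tendsto (fun T : ℝ≥0 => (T : ℝ)⁻¹) atTop (𝓝 0) := tendsto_inv_atTop_zero.comp hT
  have hlim : Tendsto (fun T : ℝ≥0 => 2 * (u : ℝ) ^ 2 - (u : ℝ) ^ 3 * (T : ℝ)⁻¹ +
      2 * u * (dist (c u) (c' T) - T) + u * ((dist (c u) (c' T) - T) ^ 2 * (T : ℝ)⁻¹)) atTop
      (𝓝 (2 * (u : ℝ) ^ 2 - (u : ℝ) ^ 3 * 0 + 2 * u * busemann c' (c u) +
        u * (busemann c' (c u) ^ 2 * 0))) :=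
    ((tendsto_const_nhds.sub (hinv.const_mul _)).add (hb.const_mul _)).add
      (((hb.pow 2).mul hinv).const_mul _)
  simp only [mul_zero, sub_zero, add_zero] at hlim
  refine ge_of_tendsto hlim ?_
  filter_upwards [eventually_ge_atTop u, eventually_gt_atTop 0] with T huT hT0
  have hT0' : (0 : ℝ) < T := hT0
  have huT' : (u : ℝ) ≤ T := huT
  have key := hX.dist_sq_le (p := c' 0) (q := c' T) (x := c' u) (c u) (l := (u : ℝ) / T)
    (by positivity) ((div_le_one hT0').2 huT')
    (by rw [c'.dist_zero_apply, c'.dist_zero_apply]; field_simp)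
    (by rw [c'.dist_zero_apply, c'.dist_apply_of_le huT]; field_simp)
  rw [c'.dist_zero_apply, ← h0, c.dist_zero_apply, dist_comm (c' u), dist_comm (c' T)] at key
  refine key.trans (le_of_eq ?_)
  field_simp
  ring

theorem tendsto_busemann_atTop_of_ne [ProperSpace X] (hX : IsCAT0 X) {κ : ℝ → ℝ}
    (hκ : IsSublinearGauge κ) {c c' : GeodesicRay X} (hc : IsContracting κ c) (h0 : c 0 = c' 0)
    (hne : c ≠ c') : Tendsto (fun s : ℝ≥0 => busemann c (c' s)) atTop atTop := by
  obtain ⟨C, hC⟩ := exists_le_busemann_apply hX hκ hc h0 hne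
  refine tendsto_atTop_mono' _ hC ?_
  exact tendsto_atTop_add_const_right _ (-C)
    ((NNReal.tendsto_coe_atTop.2 tendsto_id).atTop_div_const two_pos)

theorem tendsto_busemann_atTop_of_ne' [ProperSpace X] (hX : IsCAT0 X) {κ : ℝ → ℝ}
    (hκ : IsSublinearGauge κ) {c c' : GeodesicRay X} (hc : IsContracting κ c) (h0 : c 0 = c' 0)
    (hne : c ≠ c') : Tendsto (fun t : ℝ≥0 => busemann c' (c t)) atTop atTop := by
  obtain ⟨C, hC⟩ := exists_le_busemann_apply hX hκ hc h0 hne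
  have hT : Tendsto (fun T : ℝ≥0 => (T : ℝ)) atTop atTop := NNReal.tendsto_coe_atTop.2 tendsto_id
  refine tendsto_atTop_mono' (f₁ := fun t : ℝ≥0 => (t : ℝ) / 8 + -(3 / 2 * C)) _ ?_
    (tendsto_atTop_add_const_right _ _ (hT.atTop_div_const (by norm_num)))
  filter_upwards [hC, eventually_gt_atTop 0, hT.eventually_ge_atTop C] with u hu hu0 huC
  have hu0' : (0 : ℝ) < u := hu0
  have h1 := c.busemann_le (c' u) u
  rw [dist_comm] at h1
  -- Since `(3 / 2) ^ 2 > 2`, this beats the term `2 * u ^ 2` and leaves linear growth.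
  have h2 : (3 / 2 * (u : ℝ) - C) ^ 2 ≤ dist (c u) (c' u) ^ 2 :=
    pow_le_pow_left₀ (by linarith) (by linarith) 2
  have h3 := h2.trans (dist_sq_le_busemann hX h0 u)
  have h4 : 2 * (u : ℝ) * (u / 8 + -(3 / 2 * C)) ≤ 2 * u * busemann c' (c u) := by
    nlinarith [sq_nonneg C]
  exact le_of_mul_le_mul_left h4 (by positivity)

/-! ### Convergence in the cone topology. -/

theorem convergesToBoundary [ProperSpace X] (hX : IsCAT0 X) {κ : ℝ → ℝ}
    (hκ : IsSublinearGauge κ) {c : GeodesicRay X} (hc : IsContracting κ c) {x : ℕ → X}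
    (hx : Tendsto (fun k => busemann c (x k)) atTop atBot) :
    ConvergesToBoundary x c.endpoint := by
  intro o
  rw [TopologicalSpace.tendsto_nhds_generateFrom_iff]
  rintro s (⟨y, r, rfl⟩ | ⟨b, r, ε, rfl, hr, hε, rfl⟩) hs
  · obtain ⟨z, -, hz⟩ := hs
    cases hz
  · rcases hs with ⟨z, -, hz⟩ | ⟨ξ, ⟨d, hd0, hdc, hdr⟩, hξ⟩
    · cases hz
    cases hξ
    -- The divergence threshold is the room `ε - dist (d r) (b r)` left around `d r`: a segment
    -- missing the neighbourhood at time `r` is at least this far from `d r`.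
    obtain ⟨C, hC⟩ := exists_le_busemann_of_diverging hX hκ hc (asymptotic_of_endpoint_eq hdc) hr
      (sub_pos.2 hdr)
    filter_upwards [hx.eventually_lt_atBot (-C),
      hx.eventually_lt_atBot (-(r + dist (c 0) (b 0)))] with k hk1 hk2
    have hL : (r : ℝ) < dist (b 0) (x k) := by
      linarith [c.neg_dist_le_busemann (x k), dist_triangle (c 0) (b 0) (x k)]
    obtain ⟨γ, hγ0, hγ1, hγ⟩ := hX.exists_geodesic (b 0) (x k)
    have hrI : (r : ℝ) ∈ Icc 0 (dist (b 0) (x k)) := ⟨r.coe_nonneg, hL.le⟩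
    refine Or.inl ⟨x k, ⟨hL, γ r, ?_, ?_, ?_⟩, rfl⟩
    · rw [← hγ0, hγ 0 ⟨le_rfl, dist_nonneg⟩ r hrI, zero_sub, abs_neg, abs_of_nonneg r.coe_nonneg]
    · rw [← hγ1, hγ r hrI _ ⟨dist_nonneg, le_rfl⟩, hγ1, abs_sub_comm,
        abs_of_nonneg (sub_nonneg.2 hL.le)]
    · by_contra! hcon
      have h1 := hC _ γ (hγ0.trans hd0.symm) hL.le hγ
        (by linarith [dist_triangle (γ r) (d r) (b r)])
      rw [hγ1] at h1
      linarith [dist_nonneg (x := b 0) (y := x k)]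

/-! ### Intersections of horoballs. -/

theorem mul_busemann_le (hX : IsCAT0 X) (c : GeodesicRay X) {x y : X} {l : ℝ} (hl0 : 0 ≤ l)
    (hl1 : l ≤ 1) (hy : dist (c 0) y = l * dist (c 0) x)
    (hyx : dist y x = (1 - l) * dist (c 0) x) : busemann c y ≤ l * busemann c x := by
  refine le_of_tendsto_of_tendsto' (tendsto_busemann c y)
    ((tendsto_busemann c x).const_mul l) fun t => ?_
  have := hX.dist_le_convex (c t) hl0 hl1 hy hyx
  rw [c.dist_zero_apply] at this
  linarith

theorem exists_dist_le_of_busemann_le [ProperSpace X] (hX : IsCAT0 X) {κ : ℝ → ℝ}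
    (hκ : IsSublinearGauge κ) {c c' : GeodesicRay X} (hc : IsContracting κ c) (h0 : c 0 = c' 0)
    (hne : c ≠ c') (A A' : ℝ) :
    ∃ R : ℝ, ∀ x, busemann c x ≤ A → busemann c' x ≤ A' → dist (c 0) x ≤ R := by
  -- With the value at least `2` at `c r`, `busemann c'` stays at least `1` within distance `1` of
  -- `c r`, as it is 1-Lipschitz.
  obtain ⟨r, hr2, hr0⟩ := (((tendsto_busemann_atTop_of_ne' hX hκ hc h0 hne).eventually_ge_atTop
    2).and (eventually_gt_atTop 0)).exists
  have hr0' : (0 : ℝ) < r := hr0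
  obtain ⟨C, hC⟩ := exists_le_busemann_of_diverging hX hκ hc c.asymptotic_refl hr0 one_pos
  refine ⟨max r (max (2 * (A + C)) (r * A')), fun x hxA hxA' => ?_⟩
  rcases le_or_gt (dist (c 0) x) r with hL | hL
  · exact hL.trans (le_max_left _ _)
  refine le_trans ?_ (le_max_right _ _)
  have hL0 : 0 < dist (c 0) x := hr0'.trans hL
  obtain ⟨γ, hγ0, hγ1, hγ⟩ := hX.exists_geodesic (c 0) x
  have hrI : (r : ℝ) ∈ Icc 0 (dist (c 0) x) := ⟨r.coe_nonneg, hL.le⟩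
  rcases le_or_gt 1 (dist (γ r) (c r)) with h1 | h1
  · have h2 := hC _ γ hγ0 hL.le hγ h1
    rw [hγ1] at h2
    exact le_trans (by linarith) (le_max_left _ _)
  · have h2 : busemann c' (γ r) ≤ r / dist (c 0) x * busemann c' x := by
      refine c'.mul_busemann_le hX (by positivity) ((div_le_one hL0).2 hL.le) ?_ ?_
      · rw [← h0, div_mul_cancel₀ _ hL0.ne', ← hγ0, hγ 0 ⟨le_rfl, dist_nonneg⟩ r hrI, zero_sub,
          abs_neg, abs_of_nonneg r.coe_nonneg]
      · have h3 := hγ r hrI _ ⟨dist_nonneg, le_rfl⟩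
        rw [hγ1, abs_sub_comm, abs_of_nonneg (sub_nonneg.2 hL.le)] at h3
        rw [h3, ← h0]
        field_simp
    have h3 := c'.busemann_le_add_dist (c r) (γ r)
    rw [dist_comm] at h3
    have h4 : 1 ≤ r / dist (c 0) x * busemann c' x := by linarith
    rw [div_mul_eq_mul_div, le_div_iff₀ hL0, one_mul] at h4
    exact le_trans (h4.trans (by gcongr)) (le_max_right _ _)

end GeodesicRay

theorem IsHoroballAt.exists_busemann_le {X : Type*} [MetricSpace X] {c : GeodesicRay X}
    {B : Set X} (hB : IsHoroballAt c.endpoint B) : ∃ A : ℝ, ∀ x ∈ B, busemann c x ≤ A := by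
  obtain ⟨d, hd, h, ⟨ν, hν⟩, k, rfl⟩ := hB
  obtain ⟨M, hM⟩ := GeodesicRay.asymptotic_of_endpoint_eq hd
  refine ⟨-k - ν + M, fun x hx => ?_⟩
  have h1 : h x ≤ -k := hx
  linarith [hν x, GeodesicRay.busemann_le_add_of_dist_le hM x]

theorem theoremA {X : Type*} [MetricSpace X] [ProperSpace X] (hX : IsCAT0 X)
    (κ : ℝ → ℝ) (hκ : IsSublinearGauge κ)
    (c c' : GeodesicRay X) (h0 : c 0 = c' 0) (hne : c ≠ c') (hc : IsContracting κ c)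
    (h : X → ℝ) (hh : IsHorofunctionOf c h) :
    ((∀ x : ℕ → X, Tendsto (fun k => h (x k)) atTop atBot → ConvergesToBoundary x c.endpoint) ∧
      HorospheresConvergeTo h c.endpoint) ∧
    (∀ B B' : Set X, IsHoroballAt c.endpoint B → IsHoroballAt c'.endpoint B' →
      Bornology.IsBounded (B ∩ B')) ∧
    (∀ h' : X → ℝ, IsHorofunctionOf c' h' →
      Tendsto (fun s : ℝ≥0 => h (c' s)) atTop atTop ∧
      Tendsto (fun t : ℝ≥0 => h' (c t)) atTop atTop) := by
  obtain ⟨ν, hν⟩ := hh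
  have hconv : ∀ x : ℕ → X, Tendsto (fun k => h (x k)) atTop atBot →
      ConvergesToBoundary x c.endpoint := fun x hx => by
    refine GeodesicRay.convergesToBoundary hX hκ hc ?_
    simpa [hν] using tendsto_atBot_add_const_right _ (-ν) hx
  refine ⟨⟨hconv, fun x hx => hconv x ?_⟩, fun B B' hB hB' => ?_, ?_⟩
  · have : ∀ k : ℕ, h (x k) = -(k : ℝ) := hx
    simp only [this]
    exact tendsto_neg_atTop_atBot.comp tendsto_natCast_atTop_atTop
  · obtain ⟨A, hA⟩ := hB.exists_busemann_le
    obtain ⟨A', hA'⟩ := hB'.exists_busemann_le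
    obtain ⟨R, hR⟩ := GeodesicRay.exists_dist_le_of_busemann_le hX hκ hc h0 hne A A'
    refine (Metric.isBounded_closedBall (x := c 0) (r := R)).subset fun x hx => ?_
    rw [Metric.mem_closedBall, dist_comm]
    exact hR x (hA x hx.1) (hA' x hx.2)
  · rintro h' ⟨ν', hν'⟩
    simp only [hν, hν']
    exact ⟨tendsto_atTop_add_const_right _ _
        (GeodesicRay.tendsto_busemann_atTop_of_ne hX hκ hc h0 hne),
      tendsto_atTop_add_const_right _ _
        (GeodesicRay.tendsto_busemann_atTop_of_ne' hX hκ hc h0 hne)⟩
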